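/- Conventions. All Banach lattices are real. For a subset $A$ of a Banach lattice $X$, let $L(A)$ (resp. $I(A)$) denote the smallest norm-closed sublattice (resp. norm-closed ideal) of $X$ containing $A$; here a sublattice is a linear subspace closed under $\vee$ and $\wedge$, and an ideal is a linear subspace $Z$ such that $|x|\le |z|$ with $z\in Z$ implies $x\in Z$. $X$ is LWCG (resp. IWCG) if there is a weakly compact set $K\subset X$ with $X=L(K)$ (resp. $X=I(K)$). A Banach lattice is order continuous if every net decreasing to $0$ (i.e. decreasing with infimum $0$) converges to $0$ in norm. The dual $Y^*$ of a Banach lattice $Y$ carries the dual norm and the order $f\le g \iff f(y)\le g(y)$ for all $y\ge 0$. An operator (bounded linear map) $T:Y\to X$ between Banach lattices is a lattice homomorphism if $T(y_1\vee y_2)=Ty_1\vee Ty_2$ for all $y_1,y_2\in Y$; it is interval preserving if it is positive and $T([0,y])=[0,Ty]$ for all $y\ge 0$. Theorem. Let $X$ be a Banach lattice. 1. If $X$ is LWCG, then there exist an LWCG Banach lattice $Y$ and a lattice homomorphism $J:Y\to X$ such that (i) $Y^*$ is order continuous, and (ii) $X=\overline{J(Y)}$. 2. If $X$ is IWCG,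 then there exist an IWCG Banach lattice $Y$ and an interval preserving lattice homomorphism $J:Y\to X$ such that (i) $Y^*$ is order continuous, and (ii) $X=\overline{J(Y)}$. -/

import Mathlib

universe u

namespace BanachLattice

section Generation

variable {E : Type*} [NormedAddCommGroup E] [NormedSpace ℝ E] [Lattice E]

/-- A closed sublattice: a norm-closed linear subspace which is stable under `⊔` and `⊓`. -/
def IsClosedSublattice (S : Submodule ℝ E) : Prop :=
  IsClosed (S : Set E) ∧ ∀ x ∈ S, ∀ y ∈ S, x ⊔ y ∈ S ∧ x ⊓ y ∈ S

/-- A closed ideal: a norm-closed linear subspace `S` such that `|x| ≤ |y|` with `y ∈ S`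
implies `x ∈ S`. -/
def IsClosedIdeal (S : Submodule ℝ E) : Prop :=
  IsClosed (S : Set E) ∧ ∀ x y : E, y ∈ S → |x| ≤ |y| → x ∈ S

/-- `L(A)`, the smallest closed sublattice containing `A`. -/
def latticeSpan (A : Set E) : Submodule ℝ E :=
  sInf {S : Submodule ℝ E | IsClosedSublattice S ∧ A ⊆ S}

/-- `I(A)`, the smallest closed ideal containing `A`. -/
def idealSpan (A : Set E) : Submodule ℝ E :=
  sInf {S : Submodule ℝ E | IsClosedIdeal S ∧ A ⊆ S}

/-- Compactness of a set for the weak topology of a normed space. -/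
def IsWeaklyCompact {F : Type*} [NormedAddCommGroup F] [NormedSpace ℝ F] (K : Set F) : Prop :=
  IsCompact (toWeakSpace ℝ F '' K)

/-- Weakly compactly generated as a lattice. -/
def LWCG (E : Type*) [NormedAddCommGroup E] [NormedSpace ℝ E] [Lattice E] : Prop :=
  ∃ K : Set E, IsWeaklyCompact K ∧ latticeSpan K = ⊤

/-- Weakly compactly generated as an ideal. -/
def IWCG (E : Type*) [NormedAddCommGroup E] [NormedSpace ℝ E] [Lattice E] : Prop :=
  ∃ K : Set E, IsWeaklyCompact K ∧ idealSpan K = ⊤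

end Generation

section Operators

variable {E F : Type*} [NormedAddCommGroup E] [NormedSpace ℝ E] [Lattice E]
  [NormedAddCommGroup F] [NormedSpace ℝ F] [Lattice F]

/-- A lattice homomorphism between Banach lattices: a bounded operator preserving `⊔`
(by linearity it then preserves `⊓` as well). -/
def IsLatticeHom (T : E →L[ℝ] F) : Prop :=
  ∀ x y : E, T (x ⊔ y) = T x ⊔ T y

/-- An interval preserving operator: it is positive and `T[0, x] = [0, T x]` for all `x ≥ 0`. -/
def IsIntervalPreserving (T : E →L[ℝ] F) : Prop :=
  (∀ x : E, 0 ≤ x → 0 ≤ T x) ∧ ∀ x : E, 0 ≤ x → T '' Set.Icc 0 x = Set.Icc 0 (T x)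

end Operators

section OrderContinuity

/-- Order continuity of the norm: every net decreasing to `0` converges to `0` in norm.
It is enough to consider nets given by nonempty downward directed sets `D` with infimum `0`
(indexed by themselves): a general decreasing net is eventually below each of its values. -/
def HasOrderContinuousNorm (E : Type*) [NormedAddCommGroup E] [PartialOrder E] : Prop :=
  ∀ D : Set E, D.Nonempty → DirectedOn (fun x y => y ≤ x) D → IsGLB D 0 →
    ∀ ε : ℝ, 0 < ε → ∃ x ∈ D, ∀ y ∈ D, y ≤ x → ‖y‖ < ε

/-- The canonical order of the topological dual of a Banach lattice: `f ≤ g` if and only if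
`f x ≤ g x` for all `x ≥ 0`. -/
@[reducible]
def dualOrder (E : Type*) [NormedAddCommGroup E] [NormedSpace ℝ E] [Lattice E]
    [IsOrderedAddMonoid E] : PartialOrder (StrongDual ℝ E) where
  le f g := ∀ x : E, 0 ≤ x → f x ≤ g x
  le_refl _ _ _ := le_rfl
  le_trans _ _ _ hfg hgh x hx := (hfg x hx).trans (hgh x hx)
  le_antisymm f g hfg hgf := by
    have key : ∀ x : E, 0 ≤ x → f x = g x := fun x hx => le_antisymm (hfg x hx) (hgf x hx)
    ext x
    rw [← posPart_sub_negPart x, map_sub, map_sub, key _ (posPart_nonneg x),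
      key _ (negPart_nonneg x)]

/-- The dual `E*`, with the operator norm and its canonical order, is order continuous. -/
def HasOrderContinuousDual (E : Type*) [NormedAddCommGroup E] [NormedSpace ℝ E] [Lattice E]
    [IsOrderedAddMonoid E] : Prop :=
  @HasOrderContinuousNorm (StrongDual ℝ E) _ (dualOrder E)

end OrderContinuity

end BanachLattice

/-!
The factorization is a lattice version of the Davis–Figiel–Johnson–Pełczyński construction.

Let `K` be a weakly compact set generating `X`, and let `W` be the convex hull of `0` and the moduli
`|k|`, `k ∈ K`. The gauges `p n` of the solid sets `{x : ‖(|x| - t w)⁺‖ ≤ 1 / t for some w ∈ W}`,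
with `t = n + 1`, are lattice norms equivalent to that of `X`, and `p n ≤ 1 / (n + 1)` on `K`. The
space `Y₀` of all `x` with `p n x → 0`, normed by `sup p n`, is a Banach lattice and an ideal of `X`
which contains `K`. The space `Y` is the closed sublattice, or the closed ideal, that `K` generates
in `Y₀`, and `J` is the inclusion. Its range is dense since its closure is a closed sublattice, or
ideal, containing `K`.

Because `Y₀` is normed in the manner of a `c₀`-sum, a gliding hump shows that the adjoint of the
inclusion has dense range (`SolidScale.Space.hasDenseAdjoint_inclCLM`). This passes to subspaces, so
the weak topologies of `Y` and `X` agree on bounded subsets of `Y`, and `K` is weakly compact in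
`Y`.

For the order continuity of `Y*`, let `f` run through a downward directed set of functionals with
infimum `0`. Such `f` tend to `0` pointwise on the positive cone (`exists_lt_of_isGLB`), and, `K`
being weakly compact, even uniformly on the moduli of elements of `K`
(`IsWeaklyCompact.exists_forall_abs_lt`). The latter replaces the Dunford–Pettis criterion for weak
compactness in `L¹`; it is proved by a Schur-type gliding hump. It follows that `f` is uniformly
small on `W`. Each positive element of the unit ball of `Y` lies below a multiple of an element of
`W`, up to an element of `Y` that is small in `X`; on such elements a fixed `f₀ ≥ f` is small,
because it is nearly a functional on `X` (`hasOrderContinuousDual_of_approx`).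
-/

namespace BanachLattice

open Filter Topology

/-! ### Weak compactness and ultrafilters -/

section WeakCompactness

variable {F : Type*} [NormedAddCommGroup F] [NormedSpace ℝ F]

/-- Weak compactness in terms of ultrafilters of the normed space itself, without mention of the
weak topology. -/
theorem isWeaklyCompact_iff_ultrafilter {K : Set F} :
    IsWeaklyCompact K ↔ ∀ 𝒰 : Ultrafilter F, K ∈ 𝒰 →
      ∃ k ∈ K, ∀ φ : StrongDual ℝ F, Tendsto φ 𝒰 (𝓝 (φ k)) := by
  unfold IsWeaklyCompact
  rw [isCompact_iff_ultrafilter_le_nhds]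
  constructor
  · intro h 𝒰 hK
    obtain ⟨x, ⟨k, hk, rfl⟩, hx⟩ := h (𝒰.map (toWeakSpace ℝ F)) (by
      rw [le_principal_iff]
      exact mem_of_superset hK (Set.subset_preimage_image _ _))
    refine ⟨k, hk, fun φ => ?_⟩
    have hφ : Continuous fun x : WeakSpace ℝ F => (topDualPairing ℝ F).flip x φ :=
      WeakBilin.eval_continuous _ φ
    exact (hφ.tendsto (toWeakSpace ℝ F k)).comp hx
  · intro h 𝒱 hK
    obtain ⟨k, hk, hφ⟩ := h (𝒱.map (toWeakSpace ℝ F).symm) (by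
      refine mem_of_superset (le_principal_iff.1 hK) ?_
      rintro _ ⟨k, hk, rfl⟩
      exact hk)
    refine ⟨toWeakSpace ℝ F k, ⟨k, hk, rfl⟩, ?_⟩
    have hinj : Function.Injective (topDualPairing ℝ F).flip := by
      intro x y hxy
      by_contra hne
      obtain ⟨φ, hφ⟩ := SeparatingDual.exists_separating_of_ne (R := ℝ) hne
      exact hφ (LinearMap.congr_fun hxy φ)
    exact (WeakBilin.tendsto_iff_forall_eval_tendsto (f := id) _ hinj).2 fun φ => hφ φ

/-- Weakly compact sets are norm bounded, by the uniform boundedness principle in the bidual. -/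
theorem IsWeaklyCompact.exists_norm_le {K : Set F} (hK : IsWeaklyCompact K) :
    ∃ C, ∀ k ∈ K, ‖k‖ ≤ C := by
  obtain ⟨C, hC⟩ := banach_steinhaus
    (g := fun k : K => NormedSpace.inclusionInDoubleDual ℝ F (k : F)) (fun φ => by
      have hcont : Continuous fun x : WeakSpace ℝ F => (topDualPairing ℝ F).flip x φ :=
        WeakBilin.eval_continuous _ φ
      obtain ⟨C, hC⟩ := IsCompact.exists_bound_of_continuousOn hK hcont.continuousOn
      exact ⟨C, fun k => hC _ ⟨k, k.2, rfl⟩⟩)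
  refine ⟨C, fun k hk => ?_⟩
  have := hC ⟨k, hk⟩
  rwa [← (NormedSpace.inclusionInDoubleDualLi ℝ).norm_map k]

/-- A directed set carries an ultrafilter finer than its filter of tails. -/
theorem exists_ultrafilter_of_directedOn {α : Type*} {r : α → α → Prop} (hrefl : ∀ a, r a a)
    (htrans : ∀ a b c, r a b → r b c → r a c) {D : Set α} (hne : D.Nonempty)
    (hdir : DirectedOn r D) :
    ∃ 𝒰 : Ultrafilter α, ∀ f ∈ D, ∀ᶠ g in (𝒰 : Filter α), g ∈ D ∧ r f g := by
  have : Nonempty D := hne.to_subtype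
  have hNB : (⨅ f : D, 𝓟 {g | g ∈ D ∧ r f g}).NeBot := by
    refine iInf_neBot_of_directed' (f := fun f : D => 𝓟 {g | g ∈ D ∧ r f g})
      (fun a b => ?_) fun f : D => principal_neBot_iff.2 ⟨f, f.2, hrefl _⟩
    obtain ⟨c, hc, hac, hbc⟩ := hdir a a.2 b b.2
    refine ⟨⟨c, hc⟩, ?_, ?_⟩ <;> simp only [ge_iff_le, principal_mono]
    · exact fun g hg => ⟨hg.1, htrans _ _ _ hac hg.2⟩
    · exact fun g hg => ⟨hg.1, htrans _ _ _ hbc hg.2⟩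
  refine ⟨Ultrafilter.of (⨅ f : D, 𝓟 {g | g ∈ D ∧ r f g}), fun f hf =>
    Ultrafilter.of_le _ ?_⟩
  exact mem_iInf_of_mem ⟨f, hf⟩ (mem_principal_self _)

/-- Hahn–Banach: a bounded seminorm is attained at any given point by a functional it dominates. -/
theorem exists_dual_eq_of_seminorm_le (N : Seminorm ℝ F) {C : ℝ} (hN : ∀ v, N v ≤ C * ‖v‖) (x : F) :
    ∃ h : StrongDual ℝ F, (∀ v, |h v| ≤ N v) ∧ h x = N x := by
  rcases eq_or_ne x 0 with rfl | hx
  · exact ⟨0, fun v => by simp, by simp⟩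
  obtain ⟨g, hg, hgN⟩ := exists_extension_of_le_sublinear
    (LinearPMap.mkSpanSingleton x (N x) hx) N
    (fun c hc v => by rw [map_smul_eq_mul, Real.norm_of_nonneg hc.le]) (map_add_le_add N) (by
      rintro ⟨y, hy⟩
      obtain ⟨c, rfl⟩ := Submodule.mem_span_singleton.1 hy
      rw [LinearPMap.mkSpanSingleton'_apply, map_smul_eq_mul, smul_eq_mul, RingHom.id_apply]
      exact mul_le_mul_of_nonneg_right (le_abs_self c) (apply_nonneg N x))
  have habs : ∀ v, |g v| ≤ N v := fun v => by
    refine abs_le'.2 ⟨hgN v, ?_⟩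
    simpa only [map_neg, map_neg_eq_map] using hgN (-v)
  refine ⟨g.mkContinuous C fun v => (habs v).trans (hN v), habs, ?_⟩
  exact (hg ⟨x, Submodule.mem_span_singleton_self x⟩).trans
    (LinearPMap.mkSpanSingleton'_apply_self _ _ _ _)

end WeakCompactness

/-! ### Positive functionals on a normed lattice -/

section Functionals

variable {E : Type*} [NormedAddCommGroup E] [NormedSpace ℝ E] [Lattice E]

theorem smul_sup_of_nonneg [IsOrderedModule ℝ E] {c : ℝ} (hc : 0 ≤ c) (x y : E) :
    c • (x ⊔ y) = c • x ⊔ c • y := by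
  rcases hc.eq_or_lt with rfl | hc
  · simp
  · exact map_sup (OrderIso.smulRight (β := E) hc) x y

theorem lattice_abs_smul [IsOrderedModule ℝ E] (c : ℝ) (x : E) : |c • x| = |c| • |x| := by
  have key : ∀ c : ℝ, 0 ≤ c → |c • x| = c • |x| := fun c hc => by
    rw [abs, abs, smul_sup_of_nonneg hc, smul_neg]
  rcases le_total 0 c with hc | hc
  · rw [key c hc, abs_of_nonneg hc]
  · rw [← _root_.abs_neg, ← neg_smul, key (-c) (neg_nonneg.2 hc), abs_of_nonpos hc]

variable [IsOrderedAddMonoid E]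

theorem abs_map_le {f : StrongDual ℝ E} (hf : ∀ v, 0 ≤ v → 0 ≤ f v) (v : E) :
    |f v| ≤ f |v| := by
  rw [abs_le]
  have h1 := hf (|v| - v) (sub_nonneg.2 (le_abs_self v))
  have h2 := hf (|v| + v) (by rw [← neg_le_iff_add_nonneg]; exact neg_le_abs v)
  simp only [map_sub, map_add] at h1 h2
  constructor <;> linarith

/-- A downward directed set of positive functionals with infimum `0` decreases to `0` pointwise on
the positive cone: the pointwise limit along an ultrafilter of tails is a bounded functional below
all members of the set, hence is `≤ 0`. -/
theorem exists_lt_of_isGLB [HasSolidNorm E]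
    {D : Set (StrongDual ℝ E)} (hne : D.Nonempty)
    (hdir : DirectedOn (fun f g => ∀ v, 0 ≤ v → g v ≤ f v) D)
    (hpos : ∀ f ∈ D, ∀ v, 0 ≤ v → 0 ≤ f v)
    (hmax : ∀ g : StrongDual ℝ E, (∀ f ∈ D, ∀ v, 0 ≤ v → g v ≤ f v) → ∀ v, 0 ≤ v → g v ≤ 0)
    {v : E} (hv : 0 ≤ v) {ε : ℝ} (hε : 0 < ε) : ∃ f ∈ D, f v < ε := by
  obtain ⟨𝒰, h𝒰⟩ := exists_ultrafilter_of_directedOn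
    (r := fun f g : StrongDual ℝ E => ∀ v, 0 ≤ v → g v ≤ f v) (fun _ _ _ => le_rfl)
    (fun _ _ _ h1 h2 v hv => (h2 v hv).trans (h1 v hv)) hne hdir
  obtain ⟨f₀, hf₀⟩ := id hne
  have hbd : ∀ v, ∀ᶠ g : StrongDual ℝ E in (𝒰 : Filter _), g v ∈ Set.Icc (-f₀ |v|) (f₀ |v|) :=
    fun v => (h𝒰 f₀ hf₀).mono fun g hg =>
      abs_le.1 ((abs_map_le (hpos g hg.1) v).trans (hg.2 _ (abs_nonneg v)))
  have hlim : ∀ v, ∃ a ∈ Set.Icc (-f₀ |v|) (f₀ |v|),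
      Tendsto (fun g : StrongDual ℝ E => g v) 𝒰 (𝓝 a) := fun v =>
    isCompact_iff_ultrafilter_le_nhds.1 isCompact_Icc
      (𝒰.map fun g : StrongDual ℝ E => g v) (le_principal_iff.2 (hbd v))
  choose L hL hLt using hlim
  let G : StrongDual ℝ E := LinearMap.mkContinuous
    { toFun := L
      map_add' := fun x y => tendsto_nhds_unique (hLt (x + y))
        (by simpa only [map_add] using (hLt x).add (hLt y))
      map_smul' := fun c x => tendsto_nhds_unique (hLt (c • x))
        (by
          simpa only [map_smul, RingHom.id_apply] using (hLt x).const_smul c) } ‖f₀‖ (fun x => by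
      calc ‖L x‖ ≤ f₀ |x| := abs_le.2 (hL x)
        _ ≤ ‖f₀ |x|‖ := le_abs_self _
        _ ≤ ‖f₀‖ * ‖x‖ := by simpa only [norm_abs_eq_norm] using f₀.le_opNorm |x|)
  have hG : G v ≤ 0 := hmax G (fun f hf w hw =>
    le_of_tendsto (hLt w) ((h𝒰 f hf).mono fun g hg => hg.2 w hw)) v hv
  have hev : ∀ᶠ g : StrongDual ℝ E in (𝒰 : Filter _), g v < ε :=
    (hLt v).eventually_lt_const (lt_of_le_of_lt hG hε)
  obtain ⟨g, hg, hgD⟩ := (hev.and (h𝒰 f₀ hf₀)).exists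
  exact ⟨g, hgD.1, hg⟩

/-- The lattice seminorm `v ↦ u |v|` of a positive functional `u`. -/
def absSeminorm [IsOrderedModule ℝ E] (u : StrongDual ℝ E) (hu : ∀ v, 0 ≤ v → 0 ≤ u v) :
    Seminorm ℝ E :=
  Seminorm.of (fun v => u |v|)
    (fun x y => by
      have := hu _ (sub_nonneg.2 (abs_add_le x y))
      simp only [map_sub, map_add] at this
      linarith)
    (fun c x => by rw [lattice_abs_smul, map_smul, smul_eq_mul, Real.norm_eq_abs])

/-- For a positive functional `u`, the value `u |x|` is attained at `x` by a functional in the order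
interval `[-u, u]`. -/
theorem exists_dual_abs_le [IsOrderedModule ℝ E] [HasSolidNorm E] (u : StrongDual ℝ E)
    (hu : ∀ v, 0 ≤ v → 0 ≤ u v) (x : E) :
    ∃ h : StrongDual ℝ E, (∀ v, |h v| ≤ u |v|) ∧ h x = u |x| :=
  exists_dual_eq_of_seminorm_le (absSeminorm u hu) (C := ‖u‖) (fun v => by
    have := (le_abs_self _).trans (u.le_opNorm |v|)
    rwa [norm_abs_eq_norm] at this) x

end Functionals

/-! ### Uniform convergence on moduli of weakly compact sets -/

section Uniform

variable {E : Type*} [NormedAddCommGroup E] [NormedSpace ℝ E] [Lattice E]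
  [IsOrderedAddMonoid E]

/-- If the `h j` are dominated by successive gaps `f j - g j` of a sequence
`f 0 ≥ g 0 ≥ f 1 ≥ g 1 ≥ ⋯ ≥ 0` of functionals, then `∑ h j` converges pointwise to a bounded
functional, and its tail from `a` on is dominated by `f a`. -/
theorem exists_tsum_functional [HasSolidNorm E] {f g h : ℕ → StrongDual ℝ E}
    (hg : ∀ j v, 0 ≤ v → 0 ≤ g j v)
    (hfg : ∀ j v, 0 ≤ v → f (j + 1) v ≤ g j v) (hh : ∀ j v, |h j v| ≤ f j |v| - g j |v|) :
    ∃ H : StrongDual ℝ E, ∀ v, HasSum (fun j => h j v) (H v) ∧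
      ∀ a, |H v - ∑ j ∈ Finset.range a, h j v| ≤ f a |v| := by
  have hsum : ∀ v m a, ∑ j ∈ Finset.range m, |h (j + a) v| ≤ f a |v| := by
    intro v m
    induction m with
    | zero =>
      intro a
      have h1 := hg a _ (abs_nonneg v)
      have h2 := (abs_nonneg _).trans (hh a v)
      simpa using (by linarith : 0 ≤ f a |v|)
    | succ m ih =>
      intro a
      rw [Finset.sum_range_succ']
      have h1 := ih (a + 1)
      have h2 := hfg a _ (abs_nonneg v)
      have h3 := hh a v
      simp only [zero_add]
      simp only [add_assoc, add_comm 1 a]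
      linarith
  have hsummable : ∀ v a, Summable fun j => |h (j + a) v| := fun v a =>
    summable_of_sum_range_le (fun _ => abs_nonneg _) fun m => hsum v m a
  have hS : ∀ v, Summable fun j => h j v := fun v => Summable.of_abs (hsummable v 0)
  have htail : ∀ v a, |∑' j, h (j + a) v| ≤ f a |v| := fun v a => by
    have h1 : ‖∑' j, h (j + a) v‖ ≤ ∑' j, ‖h (j + a) v‖ := norm_tsum_le_tsum_norm (hsummable v a)
    exact h1.trans (Real.tsum_le_of_sum_range_le (fun _ => abs_nonneg _) fun m => hsum v m a)
  refine ⟨LinearMap.mkContinuous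
    { toFun := fun v => ∑' j, h j v
      map_add' := fun x y => by simp only [map_add]; exact (hS x).tsum_add (hS y)
      map_smul' := fun c x => by
        simp only [map_smul, smul_eq_mul, RingHom.id_apply, tsum_mul_left] }
    ‖f 0‖ fun v => ?_, fun v => ⟨(hS v).hasSum, fun a => ?_⟩⟩
  · have h1 := (htail v 0).trans ((le_abs_self _).trans ((f 0).le_opNorm |v|))
    rwa [norm_abs_eq_norm] at h1
  · have h1 := (hS v).sum_add_tsum_nat_add a
    change |∑' j, h j v - _| ≤ _
    rw [← h1, add_sub_cancel_left]
    exact htail v a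

/-- A downward directed set of positive functionals which tends to `0` pointwise on the positive
cone tends to `0` uniformly on `{|k| : k ∈ K}`, if `K` is weakly compact.

Otherwise each `f ∈ D` has a witness `κ f ∈ K` with `ε ≤ f |κ f|`; let `z` be a weak limit of the
witnesses along an ultrafilter of tails. A gliding hump selects functionals
`f 0 ≥ g 0 ≥ f 1 ≥ ⋯` in `D`, witnesses `k j = κ (f j)`, and `h j ∈ [-(f j - g j), f j - g j]` with
`h j (k j) ≥ 7ε/8`, so that `H = ∑ h j` satisfies `H (k j) ≥ H z + ε/2` for all `j`, while
`h i (k j) → h i z` for every `i`. A weak cluster point `w` of the `k j` then has `H w = H z` and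
`H w ≥ H z + ε/2`. -/
theorem IsWeaklyCompact.exists_forall_abs_lt [IsOrderedModule ℝ E] [HasSolidNorm E]
    {K : Set E} (hK : IsWeaklyCompact K)
    {D : Set (StrongDual ℝ E)} (hne : D.Nonempty)
    (hdir : DirectedOn (fun f g => ∀ v, 0 ≤ v → g v ≤ f v) D)
    (hpos : ∀ f ∈ D, ∀ v, 0 ≤ v → 0 ≤ f v)
    (hlim : ∀ v, 0 ≤ v → ∀ ε : ℝ, 0 < ε → ∃ f ∈ D, f v < ε)
    {ε : ℝ} (hε : 0 < ε) : ∃ f ∈ D, ∀ k ∈ K, f |k| < ε := by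
  by_contra! hcon
  choose! κ hκK hκ using hcon
  obtain ⟨𝒰, h𝒰⟩ := exists_ultrafilter_of_directedOn
    (r := fun f g : StrongDual ℝ E => ∀ v, 0 ≤ v → g v ≤ f v) (fun _ _ _ => le_rfl)
    (fun _ _ _ h1 h2 v hv => (h2 v hv).trans (h1 v hv)) hne hdir
  have h𝒰D : ∀ᶠ g in (𝒰 : Filter (StrongDual ℝ E)), g ∈ D :=
    (h𝒰 _ hne.some_mem).mono fun g hg => hg.1
  obtain ⟨z, -, hz⟩ := isWeaklyCompact_iff_ultrafilter.1 hK (𝒰.map κ)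
    (h𝒰D.mono fun g hg => hκK g hg)
  -- The entries of a tuple are `(f, g, h, k, n)`. The integer `n` strictly increases along the
  -- sequence, so that the `j` errors `ε / 16 / (n + 1)` made at stage `j` add up to at
  -- most `ε / 16`.
  let T := StrongDual ℝ E × StrongDual ℝ E × StrongDual ℝ E × E × ℕ
  obtain ⟨x, hP, hr⟩ := exists_seq_of_forall_finset_exists (α := T)
    (fun t => t.1 ∈ D ∧ t.2.1 ∈ D ∧ (∀ v, |t.2.2.1 v| ≤ t.1 |v| - t.2.1 |v|) ∧
      t.2.2.2.1 ∈ K ∧ ε - ε / 8 ≤ t.2.2.1 t.2.2.2.1 ∧ t.2.1 |t.2.2.2.1| < ε / 8 ∧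
      t.1 |z| < ε / 8)
    (fun s t => (∀ v, 0 ≤ v → t.1 v ≤ s.2.1 v) ∧ s.2.2.2.2 < t.2.2.2.2 ∧
      |s.2.2.1 t.2.2.2.1 - s.2.2.1 z| ≤ ε / 16 / (t.2.2.2.2 + 1)) (by
    intro S hS
    set n : ℕ := S.sup (fun s => s.2.2.2.2) + 1 with hn
    have hη : 0 < ε / 16 / ((n : ℝ) + 1) := by positivity
    have e1 : ∀ᶠ g in (𝒰 : Filter (StrongDual ℝ E)), ∀ s ∈ S, ∀ v, 0 ≤ v → g v ≤ s.2.1 v :=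
      (Finset.eventually_all S).2 fun s hs => (h𝒰 _ (hS s hs).2.1).mono fun g hg => hg.2
    have e2 : ∀ᶠ g in (𝒰 : Filter (StrongDual ℝ E)), ∀ s ∈ S,
        |s.2.2.1 (κ g) - s.2.2.1 z| ≤ ε / 16 / ((n : ℝ) + 1) :=
      (Finset.eventually_all S).2 fun s _ => by
        have h1 : Tendsto (fun g => s.2.2.1 (κ g)) 𝒰 (𝓝 (s.2.2.1 z)) := hz s.2.2.1
        have h2 := (h1.sub_const (s.2.2.1 z)).abs
        rw [sub_self, abs_zero] at h2
        exact h2.eventually_le_const hη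
    obtain ⟨q, hqD, hq⟩ := hlim |z| (abs_nonneg z) (ε / 8) (by positivity)
    obtain ⟨f, ⟨⟨hf1, hf2⟩, hfD⟩, hfq⟩ := (((e1.and e2).and h𝒰D).and (h𝒰 q hqD)).exists
    obtain ⟨q', hq'D, hq'⟩ := hlim |κ f| (abs_nonneg _) (ε / 8) (by positivity)
    obtain ⟨g, hgD, hgf, hgq⟩ := hdir f hfD q' hq'D
    obtain ⟨h, hh, hhk⟩ := exists_dual_abs_le (f - g) (fun v hv => sub_nonneg.2 (hgf v hv)) (κ f)
    refine ⟨(f, g, h, κ f, n), ⟨hfD, hgD, hh, hκK f hfD, ?_, ?_, ?_⟩, fun s hs =>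
      ⟨hf1 s hs, ?_, hf2 s hs⟩⟩
    · have h1 := hκ f hfD
      have h2 := hgq _ (abs_nonneg (κ f))
      change ε - ε / 8 ≤ h (κ f)
      rw [hhk, sub_apply]
      linarith
    · exact (hgq _ (abs_nonneg _)).trans_lt hq'
    · exact (hfq.2 _ (abs_nonneg _)).trans_lt hq
    · exact Nat.lt_succ_of_le (Finset.le_sup (f := fun s : T => s.2.2.2.2) hs))
  set f : ℕ → StrongDual ℝ E := fun j => (x j).1
  set g : ℕ → StrongDual ℝ E := fun j => (x j).2.1
  set h : ℕ → StrongDual ℝ E := fun j => (x j).2.2.1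
  set k : ℕ → E := fun j => (x j).2.2.2.1
  have hn : ∀ j, j ≤ (x j).2.2.2.2 := fun _ =>
    (strictMono_nat_of_lt_succ fun j => (hr j (j + 1) j.lt_succ_self).2.1).le_apply
  have hclose : ∀ i j, i < j → |h i (k j) - h i z| ≤ ε / 16 / ((j : ℝ) + 1) := fun i j hij => by
    refine (hr i j hij).2.2.trans ?_
    gcongr
    exact hn j
  obtain ⟨H, hH⟩ := exists_tsum_functional (f := f) (g := g) (h := h)
    (fun j => hpos _ (hP j).2.1) (fun j => (hr j (j + 1) j.lt_succ_self).1)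
    (fun j => (hP j).2.2.1)
  have hlow : ∀ j, H z + ε / 2 ≤ H (k j) := by
    intro j
    have h1 := abs_le.1 ((hH z).2 j)
    have h2 := abs_le.1 ((hH (k j)).2 (j + 1))
    rw [Finset.sum_range_succ] at h2
    have h3 : |∑ i ∈ Finset.range j, h i (k j) - ∑ i ∈ Finset.range j, h i z| ≤ ε / 16 := by
      rw [← Finset.sum_sub_distrib]
      calc _ ≤ ∑ i ∈ Finset.range j, |h i (k j) - h i z| := Finset.abs_sum_le_sum_abs _ _
        _ ≤ ∑ i ∈ Finset.range j, ε / 16 / ((j : ℝ) + 1) :=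
          Finset.sum_le_sum fun i hi => hclose i j (Finset.mem_range.1 hi)
        _ = ε / 16 * (j / ((j : ℝ) + 1)) := by
          rw [Finset.sum_const, Finset.card_range, nsmul_eq_mul]; ring
        _ ≤ ε / 16 * 1 := by
          gcongr
          rw [div_le_one (by positivity)]
          linarith
        _ = ε / 16 := mul_one _
    have h3 := abs_le.1 h3
    have h4 : ε - ε / 8 ≤ h j (k j) := (hP j).2.2.2.2.1
    have h5 : f (j + 1) |k j| < ε / 8 :=
      ((hr j (j + 1) j.lt_succ_self).1 _ (abs_nonneg _)).trans_lt (hP j).2.2.2.2.2.1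
    have h6 : f j |z| < ε / 8 := (hP j).2.2.2.2.2.2
    linarith [h1.1, h1.2, h2.1, h2.2, h3.1, h3.2]
  obtain ⟨w, -, hw⟩ := isWeaklyCompact_iff_ultrafilter.1 hK ((hyperfilter ℕ).map k)
    (Eventually.of_forall fun j => (hP j).2.2.2.1 : ∀ᶠ j in (hyperfilter ℕ : Filter ℕ), k j ∈ K)
  have hwz : ∀ i, h i w = h i z := by
    intro i
    refine tendsto_nhds_unique (l := (hyperfilter ℕ : Filter ℕ)) (f := fun j => h i (k j))
      (hw (h i)) ?_
    refine Tendsto.mono_left ?_ Nat.hyperfilter_le_atTop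
    rw [tendsto_iff_dist_tendsto_zero]
    refine squeeze_zero' (Eventually.of_forall fun _ => dist_nonneg)
      ((eventually_gt_atTop i).mono fun j hj => hclose i j hj) ?_
    exact (tendsto_const_nhds (x := ε / 16)).div_atTop
      (tendsto_atTop_add_const_right _ 1 tendsto_natCast_atTop_atTop)
  have hHwz : H w = H z := by
    refine (hH w).1.unique ?_
    simpa only [hwz] using (hH z).1
  have : H z + ε / 2 ≤ H w := ge_of_tendsto (b := H z + ε / 2) (hw H)
    (Eventually.of_forall hlow : ∀ᶠ j in (hyperfilter ℕ : Filter ℕ), H z + ε / 2 ≤ H (k j))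
  linarith

end Uniform

/-! ### Operators whose adjoint has dense range -/

section DenseAdjoint

variable {E X : Type*} [NormedAddCommGroup E] [NormedSpace ℝ E]
  [NormedAddCommGroup X] [NormedSpace ℝ X]

/-- The adjoint `J* : X* → E*` has norm-dense range. -/
def HasDenseAdjoint (J : E →L[ℝ] X) : Prop :=
  ∀ f : StrongDual ℝ E, ∀ ε : ℝ, 0 < ε → ∃ g : StrongDual ℝ X, ‖f - g.comp J‖ ≤ ε

theorem HasDenseAdjoint.comp_subtypeL {J : E →L[ℝ] X} (hJ : HasDenseAdjoint J)
    (S : Submodule ℝ E) : HasDenseAdjoint (J.comp S.subtypeL) := by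
  intro f ε hε
  obtain ⟨F, hF, -⟩ := exists_extension_norm_eq S f
  obtain ⟨g, hg⟩ := hJ F ε hε
  refine ⟨g, ContinuousLinearMap.opNorm_le_bound _ hε.le fun x => ?_⟩
  have h1 := (F - g.comp J).le_of_opNorm_le hg (x : E)
  simpa [hF x] using h1

/-- If `f ≤ C ‖J ·‖ + ε ‖·‖`, then `f` is within `ε` of the range of the adjoint of `J`. The
functional is defined on the graph of `J`; it is extended to `X × E` under the bound
`(x, y) ↦ C ‖x‖ + ε ‖y‖`, and the extension is split into its two components. -/
theorem exists_norm_sub_comp_le (J : E →L[ℝ] X) (f : StrongDual ℝ E) {C ε : ℝ} (hε : 0 ≤ ε)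
    (h : ∀ y, f y ≤ C * ‖J y‖ + ε * ‖y‖) : ∃ g : StrongDual ℝ X, ‖f - g.comp J‖ ≤ ε := by
  wlog hC : 0 ≤ C generalizing C
  · refine this (C := 0) (fun y => (h y).trans ?_) le_rfl
    gcongr
    exact (not_le.1 hC).le
  obtain ⟨G, hG, hGN⟩ := exists_extension_of_le_sublinear (E := X × E)
    ⟨(J.toLinearMap.prod LinearMap.id).range,
      f.toLinearMap.comp ((LinearMap.snd ℝ X E).comp (Submodule.subtype _))⟩
    (fun z => C * ‖z.1‖ + ε * ‖z.2‖)
    (fun c hc z => by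
      simp only [Prod.smul_fst, Prod.smul_snd, norm_smul, Real.norm_of_nonneg hc.le]; ring)
    (fun z z' => by
      have h1 := mul_le_mul_of_nonneg_left (norm_add_le z.1 z'.1) hC
      have h2 := mul_le_mul_of_nonneg_left (norm_add_le z.2 z'.2) hε
      simp only [Prod.fst_add, Prod.snd_add]
      linarith)
    (by
      rintro ⟨_, ⟨y, rfl⟩⟩
      exact h y)
  have h1 : ∀ x, G (x, 0) ≤ C * ‖x‖ := fun x => by simpa using hGN (x, 0)
  have h2 : ∀ y, G (0, y) ≤ ε * ‖y‖ := fun y => by simpa using hGN (0, y)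
  have hGf : ∀ y, G (J y, 0) + G (0, y) = f y := fun y => by
    rw [← map_add, Prod.mk_add_mk, add_zero, zero_add]
    exact hG ⟨(J y, y), ⟨y, rfl⟩⟩
  refine ⟨(G.comp (LinearMap.inl ℝ X E)).mkContinuous C fun x => ?_,
    ContinuousLinearMap.opNorm_le_bound _ hε fun y => ?_⟩
  · refine abs_le'.2 ⟨h1 x, ?_⟩
    simpa [← map_neg] using h1 (-x)
  · have e : (f - ((G.comp (LinearMap.inl ℝ X E)).mkContinuous C fun x => by
        refine abs_le'.2 ⟨h1 x, ?_⟩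
        simpa [← map_neg] using h1 (-x)).comp J) y = G (0, y) := by
      change f y - G (J y, 0) = _
      rw [← hGf y]; ring
    rw [e]
    refine abs_le'.2 ⟨h2 y, ?_⟩
    simpa [← map_neg] using h2 (-y)

/-- If `J*` has dense range, the weak topology of `E` restricted to a bounded set is the one pulled
back from the weak topology of `X`. -/
theorem HasDenseAdjoint.isWeaklyCompact_of_image {J : E →L[ℝ] X} (hJ : HasDenseAdjoint J)
    {K : Set E} {C : ℝ} (hC : ∀ k ∈ K, ‖k‖ ≤ C) (hK : IsWeaklyCompact (J '' K)) :
    IsWeaklyCompact K := by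
  rw [isWeaklyCompact_iff_ultrafilter]
  intro 𝒰 h𝒰
  obtain ⟨_, ⟨k, hk, rfl⟩, hlim⟩ := isWeaklyCompact_iff_ultrafilter.1 hK (𝒰.map J)
    (mem_of_superset (x := K) h𝒰 (Set.subset_preimage_image J K))
  have hC0 : 0 ≤ C := (norm_nonneg k).trans (hC k hk)
  refine ⟨k, hk, fun φ => Metric.tendsto_nhds.2 fun ε hε => ?_⟩
  obtain ⟨g, hg⟩ := hJ φ (ε / 4 / (C + 1)) (by positivity)
  have hsmall : ∀ x ∈ K, |φ x - g (J x)| ≤ ε / 4 := fun x hx => by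
    calc |φ x - g (J x)| ≤ ε / 4 / (C + 1) * ‖x‖ := (φ - g.comp J).le_of_opNorm_le hg x
      _ ≤ ε / 4 / (C + 1) * (C + 1) := by
        gcongr
        exact (hC x hx).trans (by linarith)
      _ = ε / 4 := div_mul_cancel₀ _ (by positivity)
  have hev : ∀ᶠ x in (𝒰 : Filter E), dist (g (J x)) (g (J k)) < ε / 2 :=
    Metric.tendsto_nhds.1 (hlim g) (ε / 2) (by positivity)
  filter_upwards [h𝒰, hev] with x hx hd
  rw [Real.dist_eq] at hd ⊢
  have h1 := abs_le.1 (hsmall x hx)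
  have h2 := abs_le.1 (hsmall k hk)
  have h3 := abs_lt.1 hd
  rw [abs_lt]
  constructor <;> linarith

/-- If `J*` has dense range and, up to `J`-small remainders, the positive part of the unit ball of
`E` lies below multiples of convex combinations of moduli of elements of a weakly compact set `K`,
then `E*` is order continuous.

For `f` in the directed set and `v ≥ 0` in the unit ball, `v ≤ M w + b` with `J b` small. The value
`f b` is small because `f` is dominated by a fixed `f₀`, which is close to some `g ∘ J`; the value
`f w` is small because `f` is uniformly small on the moduli of elements of `K`. -/
theorem hasOrderContinuousDual_of_approx [Lattice E] [IsOrderedAddMonoid E] [IsOrderedModule ℝ E]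
    [HasSolidNorm E] {J : E →L[ℝ] X} (hJ : HasDenseAdjoint J) {K : Set E} (hK : IsWeaklyCompact K)
    (happrox : ∀ δ : ℝ, 0 < δ → ∃ M : ℝ, 0 ≤ M ∧ ∀ y : E, 0 ≤ y → ‖y‖ ≤ 1 →
      ∃ w ∈ convexHull ℝ (insert 0 ((fun k => |k|) '' K)), ‖J ((y - M • w)⁺)‖ ≤ δ) :
    HasOrderContinuousDual E := by
  intro D hne hdir hglb ε hε
  have hdir' : DirectedOn (fun f g : StrongDual ℝ E => ∀ v, 0 ≤ v → g v ≤ f v) D := hdir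
  have hpos : ∀ f ∈ D, ∀ v : E, 0 ≤ v → 0 ≤ f v := fun f hf => hglb.1 hf
  have hlim : ∀ v : E, 0 ≤ v → ∀ ε : ℝ, 0 < ε → ∃ f ∈ D, f v < ε := fun v hv ε hε =>
    exists_lt_of_isGLB hne hdir' hpos
      (fun g hg => hglb.2 (show g ∈ @lowerBounds _ (dualOrder E).toLE D from fun f hf => hg f hf))
      hv hε
  obtain ⟨f₀, hf₀⟩ := id hne
  obtain ⟨g, hg⟩ := hJ f₀ (ε / 8) (by positivity)
  obtain ⟨M, hM, hfill⟩ := happrox (ε / 8 / (‖g‖ + 1)) (by positivity)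
  obtain ⟨f₁, hf₁, hf₁K⟩ := hK.exists_forall_abs_lt hne hdir' hpos hlim
    (ε := ε / 8 / (M + 1)) (by positivity)
  obtain ⟨f₂, hf₂, h20, h21⟩ := hdir' f₀ hf₀ f₁ hf₁
  refine ⟨f₂, hf₂, fun f hf hff => ?_⟩
  have hff : ∀ v, 0 ≤ v → f v ≤ f₂ v := hff
  refine lt_of_le_of_lt (ContinuousLinearMap.opNorm_le_of_unit_norm (C := ε / 2) (by positivity)
    fun v hv => ?_) (by linarith)
  refine (abs_map_le (hpos f hf) v).trans ?_
  obtain ⟨w, hw, hwJ⟩ := hfill |v| (abs_nonneg v) (by rw [norm_abs_eq_norm, hv])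
  set b := (|v| - M • w)⁺ with hb
  have hw0 : 0 ≤ w := convexHull_min (t := Set.Ici (0 : E))
    (Set.insert_subset le_rfl (by rintro _ ⟨k, -, rfl⟩; exact abs_nonneg k))
    (convex_Ici (𝕜 := ℝ) (0 : E)) hw
  have hfw : f w ≤ ε / 8 / (M + 1) := convexHull_min (t := {x | f x ≤ ε / 8 / (M + 1)})
    (Set.insert_subset (by simp only [Set.mem_ofPred_eq, map_zero]; positivity) (by
      rintro _ ⟨k, hk, rfl⟩
      exact (hff _ (abs_nonneg k)).trans ((h21 _ (abs_nonneg k)).trans (hf₁K k hk).le)))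
    (convex_halfSpace_le f.isLinear _) hw
  have hb0 : 0 ≤ b := posPart_nonneg _
  have hbn : ‖b‖ ≤ 1 := by
    rw [← hv]
    refine norm_le_norm_of_abs_le_abs ?_
    rw [abs_of_nonneg hb0]
    exact sup_le (sub_le_self _ (smul_nonneg hM hw0)) (abs_nonneg v)
  have h1 : f |v| ≤ M * f w + f b := by
    have := hpos f hf (M • w + b - |v|) (by
      rw [sub_nonneg, ← sub_le_iff_le_add']
      exact le_posPart _)
    simp only [map_sub, map_add, map_smul, smul_eq_mul] at this
    linarith
  have h2 : f b ≤ f₀ b := (hff b hb0).trans (h20 b hb0)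
  have h3 : f₀ b - g (J b) ≤ ε / 8 := by
    refine (le_abs_self _).trans (((f₀ - g.comp J).le_of_opNorm_le hg b).trans ?_)
    exact mul_le_of_le_one_right (by positivity) hbn
  have h4 : g (J b) ≤ ε / 8 := by
    refine (le_abs_self _).trans ((g.le_opNorm _).trans ?_)
    calc ‖g‖ * ‖J b‖ ≤ (‖g‖ + 1) * (ε / 8 / (‖g‖ + 1)) := by
          gcongr
          linarith
      _ = ε / 8 := mul_div_cancel₀ _ (by positivity)
  have h5 : M * f w ≤ ε / 8 := by
    calc M * f w ≤ M * (ε / 8 / (M + 1)) := by gcongr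
      _ ≤ (M + 1) * (ε / 8 / (M + 1)) := by gcongr; linarith
      _ = ε / 8 := mul_div_cancel₀ _ (by positivity)
  linarith

end DenseAdjoint

/-! ### The Banach space of a scale of lattice seminorms -/

/-- A sequence of continuous lattice seminorms, the first of which dominates the norm up to a
constant (hence is equivalent to it). -/
structure SolidScale (X : Type u) [NormedAddCommGroup X] [NormedSpace ℝ X] [Lattice X] where
  p : ℕ → Seminorm ℝ X
  solid : ∀ n x y, |x| ≤ |y| → p n x ≤ p n y
  continuous : ∀ n, Continuous (p n)
  lower : ∃ C, ∀ x, ‖x‖ ≤ C * p 0 x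

namespace SolidScale

variable {X : Type u} [NormedAddCommGroup X] [NormedSpace ℝ X] [Lattice X] (𝔭 : SolidScale X)

/-- The subspace of the elements `x` with `p n x → 0`. -/
def toSubmodule : Submodule ℝ X where
  carrier := {x | Tendsto (fun n => 𝔭.p n x) atTop (𝓝 0)}
  zero_mem' := by simp
  add_mem' := fun {x y} hx hy => squeeze_zero (fun _ => apply_nonneg _ _)
    (fun n => map_add_le_add (𝔭.p n) x y)
    (by
      rw [Set.mem_ofPred_eq] at hx hy
      simpa using hx.add hy)
  smul_mem' := fun c x hx => by
    rw [Set.mem_ofPred_eq] at hx ⊢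
    simpa [map_smul_eq_mul] using hx.const_mul ‖c‖

theorem mem_toSubmodule {x : X} :
    x ∈ 𝔭.toSubmodule ↔ Tendsto (fun n => 𝔭.p n x) atTop (𝓝 0) := Iff.rfl

theorem mem_of_abs_le {x y : X} (hy : y ∈ 𝔭.toSubmodule) (h : |x| ≤ |y|) : x ∈ 𝔭.toSubmodule :=
  squeeze_zero (fun _ => apply_nonneg _ _) (fun n => 𝔭.solid n x y h) hy

/-- The space of the elements `x` with `p n x → 0`, to be normed by `sup n, p n x` rather than by the
norm of `X`. Up to the identification of `x` with the constant sequence `x`, it is a closed subspace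
of the `c₀`-sum of the spaces `(X, p n)`. -/
def Space : Type u := 𝔭.toSubmodule

namespace Space

instance : AddCommGroup 𝔭.Space := inferInstanceAs (AddCommGroup 𝔭.toSubmodule)

instance : Module ℝ 𝔭.Space := inferInstanceAs (Module ℝ 𝔭.toSubmodule)

/-- The inclusion of `𝔭.Space` in `X`, as a linear map. -/
def incl : 𝔭.Space →ₗ[ℝ] X := 𝔭.toSubmodule.subtype

variable {𝔭}

theorem incl_injective : Function.Injective (incl 𝔭) := Subtype.val_injective

theorem tendsto_p (y : 𝔭.Space) : Tendsto (fun n => 𝔭.p n (incl 𝔭 y)) atTop (𝓝 0) := y.2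

theorem exists_incl_of_mem {x : X} (hx : x ∈ 𝔭.toSubmodule) : ∃ y, incl 𝔭 y = x := ⟨⟨x, hx⟩, rfl⟩

theorem exists_incl_eq {x : X} {y : 𝔭.Space} (h : |x| ≤ |incl 𝔭 y|) : ∃ z, incl 𝔭 z = x :=
  ⟨⟨x, 𝔭.mem_of_abs_le y.2 h⟩, rfl⟩

noncomputable instance : Norm 𝔭.Space := ⟨fun y => ⨆ n, 𝔭.p n (incl 𝔭 y)⟩

theorem p_le_norm (y : 𝔭.Space) (n : ℕ) : 𝔭.p n (incl 𝔭 y) ≤ ‖y‖ :=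
  le_ciSup (tendsto_p y).bddAbove_range n

theorem norm_le {y : 𝔭.Space} {C : ℝ} (h : ∀ n, 𝔭.p n (incl 𝔭 y) ≤ C) : ‖y‖ ≤ C := ciSup_le h

theorem norm_nonneg' (y : 𝔭.Space) : 0 ≤ ‖y‖ := (apply_nonneg (𝔭.p 0) _).trans (p_le_norm y 0)

theorem norm_smul_le (c : ℝ) (y : 𝔭.Space) : ‖c • y‖ ≤ ‖c‖ * ‖y‖ := norm_le fun n => by
  rw [map_smul, map_smul_eq_mul]
  exact mul_le_mul_of_nonneg_left (p_le_norm y n) (norm_nonneg c)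

variable (𝔭) in
theorem core : NormedSpace.Core ℝ 𝔭.Space where
  norm_nonneg := norm_nonneg'
  norm_smul c y := by
    refine le_antisymm (norm_smul_le c y) ?_
    rcases eq_or_ne c 0 with rfl | hc
    · rw [norm_zero, zero_mul]
      exact norm_nonneg' _
    · have := norm_smul_le c⁻¹ (c • y)
      rw [inv_smul_smul₀ hc, norm_inv] at this
      rwa [← le_inv_mul_iff₀ (norm_pos_iff.2 hc)]
  norm_triangle y z := norm_le fun n => by
    rw [map_add]
    exact (map_add_le_add _ _ _).trans (add_le_add (p_le_norm y n) (p_le_norm z n))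
  norm_eq_zero_iff y := by
    constructor
    · intro h
      obtain ⟨C, hC⟩ := 𝔭.lower
      have h0 : 𝔭.p 0 (incl 𝔭 y) = 0 :=
        le_antisymm (h ▸ p_le_norm y 0) (apply_nonneg _ _)
      have := hC (incl 𝔭 y)
      rw [h0, mul_zero, norm_le_zero_iff] at this
      exact incl_injective (this.trans (map_zero _).symm)
    · rintro rfl
      exact le_antisymm (norm_le fun n => by simp) (norm_nonneg' _)

noncomputable instance : NormedAddCommGroup 𝔭.Space := NormedAddCommGroup.ofCore (core 𝔭)

noncomputable instance : NormedSpace ℝ 𝔭.Space := NormedSpace.ofCore (core 𝔭)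

variable (𝔭) in
theorem exists_norm_incl_le : ∃ C, ∀ y, ‖incl 𝔭 y‖ ≤ C * ‖y‖ := by
  obtain ⟨C, hC⟩ := 𝔭.lower
  refine ⟨|C|, fun y => (hC _).trans ?_⟩
  calc C * 𝔭.p 0 (incl 𝔭 y) ≤ |C| * 𝔭.p 0 (incl 𝔭 y) :=
        mul_le_mul_of_nonneg_right (le_abs_self C) (apply_nonneg _ _)
    _ ≤ |C| * ‖y‖ := mul_le_mul_of_nonneg_left (p_le_norm y 0) (abs_nonneg C)

variable (𝔭) in
/-- The inclusion of `𝔭.Space` in `X`, as a bounded operator. -/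
noncomputable def inclCLM : 𝔭.Space →L[ℝ] X :=
  (incl 𝔭).mkContinuousOfExistsBound (exists_norm_incl_le 𝔭)

theorem inclCLM_apply (y : 𝔭.Space) : inclCLM 𝔭 y = incl 𝔭 y := rfl

instance [CompleteSpace X] : CompleteSpace 𝔭.Space := by
  refine Metric.complete_of_cauchySeq_tendsto fun u hu => ?_
  obtain ⟨x, hx⟩ := cauchySeq_tendsto_of_complete 
    ((inclCLM 𝔭).uniformContinuous.comp_cauchySeq hu)
  replace hx : Tendsto (fun k => incl 𝔭 (u k)) atTop (𝓝 x) := hx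
  have hclose : ∀ ε > 0, ∃ N, ∀ k ≥ N, ∀ n, 𝔭.p n (incl 𝔭 (u k) - x) ≤ ε := by
    intro ε hε
    obtain ⟨N, hN⟩ := Metric.cauchySeq_iff.1 hu ε hε
    refine ⟨N, fun k hk n => ?_⟩
    have h1 : Tendsto (fun l => 𝔭.p n (incl 𝔭 (u k) - incl 𝔭 (u l))) atTop
        (𝓝 (𝔭.p n (incl 𝔭 (u k) - x))) :=
      ((𝔭.continuous n).tendsto _).comp (hx.const_sub _)
    refine le_of_tendsto h1 ((eventually_ge_atTop N).mono fun l hl => ?_)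
    rw [← map_sub]
    refine (p_le_norm _ n).trans ?_
    rw [← dist_eq_norm]
    exact (hN k hk l hl).le
  have hxmem : x ∈ 𝔭.toSubmodule := by
    rw [mem_toSubmodule, Metric.tendsto_nhds]
    intro ε hε
    obtain ⟨N, hN⟩ := hclose (ε / 2) (by positivity)
    filter_upwards [(tendsto_p (u N)).eventually_lt_const (show 0 < ε / 2 by positivity)] with n hn
    rw [Real.dist_0_eq_abs, abs_of_nonneg (apply_nonneg _ _)]
    have h1 := map_sub_le_add (𝔭.p n) (incl 𝔭 (u N)) (incl 𝔭 (u N) - x)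
    rw [sub_sub_cancel] at h1
    linarith [hN N le_rfl n]
  obtain ⟨y, rfl⟩ := exists_incl_of_mem hxmem
  refine ⟨y, Metric.tendsto_atTop'.2 fun ε hε => ?_⟩
  obtain ⟨N, hN⟩ := hclose (ε / 2) (by positivity)
  refine ⟨N, fun k hk => ?_⟩
  rw [dist_eq_norm]
  exact lt_of_le_of_lt (norm_le fun n => by
    rw [map_sub]
    exact hN k hk.le n) (by linarith)

/-- A functional on `𝔭.Space` is bounded by a multiple of the norm of `X`, up to an `ε`-fraction of
the norm of `𝔭.Space`. Otherwise there are vectors `y` of norm one with `f y ≥ ε` and arbitrarily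
small norm in `X`, so that finitely many `p n y` are as small as desired. A gliding hump then yields
sums of arbitrarily many such vectors with norm at most `2`, on which `f` is unbounded. -/
theorem exists_apply_le (f : StrongDual ℝ 𝔭.Space) {ε : ℝ} (hε : 0 < ε) :
    ∃ C, ∀ y, f y ≤ C * ‖inclCLM 𝔭 y‖ + ε * ‖y‖ := by
  by_contra! hcon
  -- Small `p n y` are needed only for those `n < N` for which `p n s` is not yet small.
  have step : ∀ (s : 𝔭.Space) (r η : ℝ), 1 ≤ r → ‖s‖ ≤ r → 0 < η →
      ∃ y, ε ≤ f y ∧ ‖s + y‖ ≤ r + η := by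
    intro s r η hr hs hη
    obtain ⟨N, hN⟩ := ((tendsto_p s).eventually_le_const hη).exists_forall_of_atTop
    choose c hc0 hc using fun n => Seminorm.bound_of_continuous_normedSpace (𝔭.p n) (𝔭.continuous n)
    set B : ℝ := ∑ n ∈ Finset.range N, c n with hB
    have hB0 : 0 ≤ B := Finset.sum_nonneg fun n _ => (hc0 n).le
    obtain ⟨y, hy⟩ := hcon (‖f‖ * B / η)
    have hy0 : 0 < ‖y‖ := by
      rw [norm_pos_iff]
      rintro rfl
      simp at hy
    have hle : f y ≤ ‖f‖ * ‖y‖ := (le_abs_self _).trans (f.le_opNorm y)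
    have hlow : ∀ n < N, 𝔭.p n (incl 𝔭 y) ≤ η * ‖y‖ := by
      intro n hn
      have h1 : c n ≤ B := Finset.single_le_sum (f := c) (fun n _ => (hc0 n).le)
        (Finset.mem_range.2 hn)
      have h2 : 𝔭.p n (incl 𝔭 y) ≤ B * ‖incl 𝔭 y‖ := (hc n _).trans (by gcongr)
      refine h2.trans ?_
      have h3 : ‖f‖ * (B * ‖incl 𝔭 y‖) ≤ ‖f‖ * (η * ‖y‖) := by
        have h4 : ‖f‖ * B / η * ‖incl 𝔭 y‖ ≤ ‖f‖ * ‖y‖ := by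
          rw [← inclCLM_apply]
          nlinarith
        rw [div_mul_eq_mul_div, div_le_iff₀ hη] at h4
        linarith
      have hf0 : 0 < ‖f‖ := by
        by_contra h0
        have h0 : ‖f‖ = 0 := le_antisymm (not_lt.1 h0) (norm_nonneg f)
        rw [h0] at hle hy
        simp only [zero_mul, zero_div, zero_add] at hle hy
        nlinarith
      exact le_of_mul_le_mul_left h3 hf0
    refine ⟨‖y‖⁻¹ • y, ?_, norm_le fun n => ?_⟩
    · rw [map_smul, smul_eq_mul, le_inv_mul_iff₀ hy0]
      have : 0 ≤ ‖f‖ * B / η * ‖inclCLM 𝔭 y‖ := by positivity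
      linarith
    · rw [map_add]
      refine (map_add_le_add _ _ _).trans ?_
      rw [map_smul, map_smul_eq_mul, norm_inv, norm_norm]
      rcases lt_or_ge n N with hn | hn
      · have h1 := (p_le_norm s n).trans hs
        have h2 : ‖y‖⁻¹ * 𝔭.p n (incl 𝔭 y) ≤ η := by
          rw [inv_mul_le_iff₀ hy0, mul_comm]
          exact hlow n hn
        linarith
      · have h1 : ‖y‖⁻¹ * 𝔭.p n (incl 𝔭 y) ≤ 1 := by
          rw [inv_mul_le_iff₀ hy0, mul_one]
          exact p_le_norm y n
        linarith [hN n hn]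
  have hsum : ∀ (m : ℕ) (η : ℝ), 0 < η → ∃ s : 𝔭.Space, ‖s‖ ≤ 1 + η ∧ m * ε ≤ f s := by
    intro m
    induction m with
    | zero => exact fun η hη => ⟨0, by simp; linarith, by simp⟩
    | succ m ih =>
      intro η hη
      obtain ⟨s, hs, hfs⟩ := ih (η / 2) (by positivity)
      obtain ⟨y, hy, hsy⟩ := step s (1 + η / 2) (η / 2) (by linarith) hs (by positivity)
      refine ⟨s + y, by linarith, ?_⟩
      rw [map_add]
      push_cast
      linarith
  obtain ⟨m, hm⟩ := exists_nat_gt (‖f‖ * 2 / ε)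
  obtain ⟨s, hs, hfs⟩ := hsum m 1 one_pos
  rw [div_lt_iff₀ hε] at hm
  have h1 : f s ≤ ‖f‖ * 2 := (le_abs_self _).trans (f.le_opNorm_of_le (by linarith))
  linarith

variable (𝔭) in
theorem hasDenseAdjoint_inclCLM : HasDenseAdjoint (inclCLM 𝔭) := fun f ε hε => by
  obtain ⟨C, hC⟩ := exists_apply_le f hε
  exact exists_norm_sub_comp_le _ f hε.le hC

end Space

end SolidScale

/-! ### Lattice structures on subspaces -/

/-- A linear subspace closed under `⊔` and `⊓`, bundled so that the subspace inherits the lattice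
structure by instance search. -/
structure VectorSublattice (E : Type*) [NormedAddCommGroup E] [NormedSpace ℝ E] [Lattice E]
    extends Submodule ℝ E where
  sup_mem' : ∀ x ∈ carrier, ∀ y ∈ carrier, x ⊔ y ∈ carrier
  inf_mem' : ∀ x ∈ carrier, ∀ y ∈ carrier, x ⊓ y ∈ carrier

namespace VectorSublattice

variable {E : Type*} [NormedAddCommGroup E] [NormedSpace ℝ E] [Lattice E]

instance (L : VectorSublattice E) : Lattice L.toSubmodule :=
  Subtype.lattice (fun x y hx hy => L.sup_mem' x hx y hy) (fun x y hx hy => L.inf_mem' x hx y hy)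

instance [IsOrderedAddMonoid E] (L : VectorSublattice E) : IsOrderedAddMonoid L.toSubmodule where
  add_le_add_left x y hxy z :=
    show (x : E) + z ≤ y + z from add_le_add_left (show (x : E) ≤ y from hxy) z

instance [IsOrderedModule ℝ E] (L : VectorSublattice E) : IsOrderedModule ℝ L.toSubmodule where
  smul_le_smul_of_nonneg_left c hc x y hxy :=
    show c • (x : E) ≤ c • (y : E) from smul_le_smul_of_nonneg_left (show (x : E) ≤ y from hxy) hc
  smul_le_smul_of_nonneg_right x hx c d hcd :=
    show c • (x : E) ≤ d • (x : E) from smul_le_smul_of_nonneg_right hcd (show (0 : E) ≤ x from hx)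

instance [HasSolidNorm E] (L : VectorSublattice E) : HasSolidNorm L.toSubmodule where
  solid x y hxy := show ‖(x : E)‖ ≤ ‖(y : E)‖ from
    norm_le_norm_of_abs_le_abs (show |(x : E)| ≤ |(y : E)| from hxy)

/-- A solid subspace is a sublattice, since `|x ⊔ y|` and `|x ⊓ y|` are at most `|x| + |y|`. -/
def ofSolid [IsOrderedAddMonoid E] (S : Submodule ℝ E)
    (hS : ∀ x y, y ∈ S → |x| ≤ |y| → x ∈ S) : VectorSublattice E where
  toSubmodule := S
  sup_mem' x hx y hy := hS _ (|x| + |y|)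
    (S.add_mem (hS _ _ hx (abs_abs x).le) (hS _ _ hy (abs_abs y).le)) (by
      rw [abs_of_nonneg (add_nonneg (abs_nonneg x) (abs_nonneg y))]
      refine abs_le'.2 ⟨sup_le ?_ ?_, ?_⟩
      · exact (le_abs_self x).trans (le_add_of_nonneg_right (abs_nonneg y))
      · exact (le_abs_self y).trans (le_add_of_nonneg_left (abs_nonneg x))
      · rw [neg_sup]
        exact inf_le_left.trans ((neg_le_abs x).trans (le_add_of_nonneg_right (abs_nonneg y))))
  inf_mem' x hx y hy := hS _ (|x| + |y|)
    (S.add_mem (hS _ _ hx (abs_abs x).le) (hS _ _ hy (abs_abs y).le)) (by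
      rw [abs_of_nonneg (add_nonneg (abs_nonneg x) (abs_nonneg y))]
      refine abs_le'.2 ⟨?_, ?_⟩
      · exact inf_le_left.trans ((le_abs_self x).trans (le_add_of_nonneg_right (abs_nonneg y)))
      · rw [neg_inf]
        refine sup_le ?_ ?_
        · exact (neg_le_abs x).trans (le_add_of_nonneg_right (abs_nonneg y))
        · exact (neg_le_abs y).trans (le_add_of_nonneg_left (abs_nonneg x)))

end VectorSublattice

namespace SolidScale

variable {X : Type u} [NormedAddCommGroup X] [NormedSpace ℝ X] [Lattice X]
  [IsOrderedAddMonoid X]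

namespace Space

variable {𝔭 : SolidScale X}

instance : Lattice 𝔭.Space := inferInstanceAs (Lattice
  (VectorSublattice.ofSolid 𝔭.toSubmodule fun _ _ => 𝔭.mem_of_abs_le).toSubmodule)

instance : IsOrderedAddMonoid 𝔭.Space := inferInstanceAs (IsOrderedAddMonoid
  (VectorSublattice.ofSolid 𝔭.toSubmodule fun _ _ => 𝔭.mem_of_abs_le).toSubmodule)

instance [IsOrderedModule ℝ X] : IsOrderedModule ℝ 𝔭.Space := inferInstanceAs (IsOrderedModule ℝ
  (VectorSublattice.ofSolid 𝔭.toSubmodule fun _ _ => 𝔭.mem_of_abs_le).toSubmodule)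

instance : HasSolidNorm 𝔭.Space where
  solid _ y hxy := norm_le fun n => (𝔭.solid n _ _ hxy).trans (p_le_norm y n)

end Space

end SolidScale

/-! ### Gauges of solid enlargements -/

section Gauge

variable {X : Type u} [NormedAddCommGroup X] [NormedSpace ℝ X] [Lattice X]

/-- The solid enlargement of a set `W` of positive elements: the `x` with `|x|` below `t • w`, for
some `w ∈ W`, up to an error of norm at most `t⁻¹`. It plays the role of the set
`t • S + t⁻¹ • B`, with `S` the solid hull of `W` and `B` the closed unit ball. -/
def solidEnlargement (W : Set X) (t : ℝ) : Set X :=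
  {x | ∃ w ∈ W, ‖(|x| - t • w)⁺‖ ≤ t⁻¹}

theorem solidEnlargement_solid [IsOrderedAddMonoid X] [HasSolidNorm X] {W : Set X} {t : ℝ} {x y : X}
    (hy : y ∈ solidEnlargement W t) (h : |x| ≤ |y|) : x ∈ solidEnlargement W t := by
  obtain ⟨w, hw, hwy⟩ := hy
  refine ⟨w, hw, le_trans (norm_le_norm_of_abs_le_abs ?_) hwy⟩
  rw [abs_of_nonneg (posPart_nonneg _), abs_of_nonneg (posPart_nonneg _)]
  exact posPart_mono (sub_le_sub_right h _)

theorem solidEnlargement_mem_nhds [IsOrderedAddMonoid X] [HasSolidNorm X] {W : Set X} {t : ℝ}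
    (h0 : 0 ∈ W) (ht : 0 < t) :
    solidEnlargement W t ∈ 𝓝 (0 : X) := by
  refine mem_of_superset (Metric.closedBall_mem_nhds 0 (inv_pos.2 ht)) fun x hx => ⟨0, h0, ?_⟩
  rw [smul_zero, sub_zero, posPart_of_nonneg (abs_nonneg x), norm_abs_eq_norm]
  exact mem_closedBall_zero_iff.1 hx

variable [IsOrderedAddMonoid X] [IsOrderedModule ℝ X] {W : Set X} {t : ℝ}

theorem gauge_solidEnlargement_le (ht : 0 < t) {w x : X} (hw : w ∈ W)
    (hx : |x| ≤ w) : gauge (solidEnlargement W t) x ≤ t⁻¹ := by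
  refine gauge_le_of_mem (inv_nonneg.2 ht.le) ⟨t • x, ⟨w, hw, ?_⟩, inv_smul_smul₀ ht.ne' x⟩
  rw [lattice_abs_smul, abs_of_pos ht, posPart_of_nonpos, norm_zero]
  · exact inv_nonneg.2 ht.le
  · rw [sub_nonpos]
    exact smul_le_smul_of_nonneg_left hx ht.le

variable [HasSolidNorm X]

theorem balanced_solidEnlargement : Balanced ℝ (solidEnlargement W t) := by
  rintro c hc _ ⟨x, hx, rfl⟩
  refine solidEnlargement_solid hx ?_
  change |c • x| ≤ |x|
  rw [lattice_abs_smul]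
  exact smul_le_of_le_one_left (abs_nonneg x) hc

theorem convex_solidEnlargement (hW : Convex ℝ W) : Convex ℝ (solidEnlargement W t) := by
  rintro x ⟨w, hw, hx⟩ y ⟨z, hz, hy⟩ a b ha hb hab
  refine ⟨a • w + b • z, hW hw hz ha hb hab, ?_⟩
  have hle : (|a • x + b • y| - t • (a • w + b • z))⁺ ≤
      a • (|x| - t • w)⁺ + b • (|y| - t • z)⁺ := by
    refine sup_le ?_ (add_nonneg (smul_nonneg ha (posPart_nonneg _))
      (smul_nonneg hb (posPart_nonneg _)))
    calc |a • x + b • y| - t • (a • w + b • z)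
        ≤ (a • |x| + b • |y|) - t • (a • w + b • z) := by
          refine sub_le_sub_right ((abs_add_le _ _).trans_eq ?_) _
          rw [lattice_abs_smul, lattice_abs_smul, abs_of_nonneg ha, abs_of_nonneg hb]
      _ = a • (|x| - t • w) + b • (|y| - t • z) := by module
      _ ≤ _ := add_le_add (smul_le_smul_of_nonneg_left (le_posPart _) ha)
          (smul_le_smul_of_nonneg_left (le_posPart _) hb)
  calc _ ≤ ‖a • (|x| - t • w)⁺ + b • (|y| - t • z)⁺‖ := by
        refine norm_le_norm_of_abs_le_abs ?_
        rw [abs_of_nonneg (posPart_nonneg _)]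
        exact hle.trans (le_abs_self _)
    _ ≤ a * t⁻¹ + b * t⁻¹ := by
        refine (norm_add_le _ _).trans ?_
        rw [norm_smul, norm_smul, Real.norm_of_nonneg ha, Real.norm_of_nonneg hb]
        gcongr
    _ = t⁻¹ := by rw [← add_mul, hab, one_mul]

theorem gauge_solidEnlargement_mono (h0 : 0 ∈ W) (ht : 0 < t) {x y : X} (h : |x| ≤ |y|) :
    gauge (solidEnlargement W t) x ≤ gauge (solidEnlargement W t) y := by
  refine le_of_forall_gt_imp_ge_of_dense fun a ha => ?_
  obtain ⟨b, hb, hba, z, hz, hzy⟩ :=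
    exists_lt_of_gauge_lt (absorbent_nhds_zero (solidEnlargement_mem_nhds h0 ht)) ha
  refine (gauge_le_of_mem hb.le
    ⟨b⁻¹ • x, solidEnlargement_solid hz ?_, smul_inv_smul₀ hb.ne' x⟩).trans hba.le
  have hz' : z = b⁻¹ • y := by rw [← hzy]; exact (inv_smul_smul₀ hb.ne' z).symm
  rw [hz', lattice_abs_smul, lattice_abs_smul]
  exact smul_le_smul_of_nonneg_left h (abs_nonneg _)

theorem norm_le_gauge_solidEnlargement (h0 : 0 ∈ W) (ht : 0 < t) {M : ℝ}
    (hM : ∀ w ∈ W, ‖w‖ ≤ M) (x : X) :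
    ‖x‖ ≤ (t * M + t⁻¹) * gauge (solidEnlargement W t) x := by
  have hM0 : 0 ≤ M := (norm_nonneg _).trans (hM 0 h0)
  have hpos : 0 < t * M + t⁻¹ := add_pos_of_nonneg_of_pos (by positivity) (inv_pos.2 ht)
  rw [← div_le_iff₀' hpos]
  refine le_of_forall_gt_imp_ge_of_dense fun a ha => ?_
  obtain ⟨b, hb, hba, z, ⟨w, hw, hz⟩, rfl⟩ :=
    exists_lt_of_gauge_lt (absorbent_nhds_zero (solidEnlargement_mem_nhds h0 ht)) ha
  rw [div_le_iff₀' hpos]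
  have hzn : ‖z‖ ≤ t * M + t⁻¹ := by
    calc ‖z‖ ≤ ‖t • |w| + (|z| - t • w)⁺‖ := by
          refine norm_le_norm_of_abs_le_abs (le_trans ?_ (le_abs_self _))
          rw [← sub_le_iff_le_add']
          refine le_trans (sub_le_sub_left ?_ _) (le_posPart _)
          exact smul_le_smul_of_nonneg_left (le_abs_self w) ht.le
      _ ≤ ‖t • |w|‖ + t⁻¹ := (norm_add_le _ _).trans (by gcongr)
      _ ≤ t * M + t⁻¹ := by
          rw [norm_smul, norm_abs_eq_norm, Real.norm_of_nonneg ht.le]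
          gcongr
          exact hM w hw
  change ‖b • z‖ ≤ _
  rw [norm_smul, Real.norm_of_nonneg hb.le, mul_comm]
  gcongr

/-- Elements of small gauge lie, in modulus, below a multiple of an element of `W`, up to a
small error. -/
theorem exists_norm_posPart_le_of_gauge_lt (hpos : ∀ w ∈ W, 0 ≤ w) (h0 : 0 ∈ W) (ht : 0 < t) {c : ℝ}
    {x : X} (hx : gauge (solidEnlargement W t) x < c) :
    ∃ w ∈ W, ‖(|x| - (c * t) • w)⁺‖ ≤ c * t⁻¹ := by
  obtain ⟨b, hb, hbc, z, ⟨w, hw, hz⟩, rfl⟩ :=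
    exists_lt_of_gauge_lt (absorbent_nhds_zero (solidEnlargement_mem_nhds h0 ht)) hx
  refine ⟨w, hw, ?_⟩
  have hle : (|b • z| - (c * t) • w)⁺ ≤ b • (|z| - t • w)⁺ := by
    refine sup_le ?_ (smul_nonneg hb.le (posPart_nonneg _))
    rw [lattice_abs_smul, abs_of_pos hb]
    calc b • |z| - (c * t) • w ≤ b • |z| - (b * t) • w := by
          refine sub_le_sub_left (smul_le_smul_of_nonneg_right ?_ (hpos w hw)) _
          gcongr
      _ = b • (|z| - t • w) := by module
      _ ≤ _ := smul_le_smul_of_nonneg_left (le_posPart _) hb.le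
  calc _ ≤ ‖b • (|z| - t • w)⁺‖ := by
        refine norm_le_norm_of_abs_le_abs ?_
        rw [abs_of_nonneg (posPart_nonneg _)]
        exact hle.trans (le_abs_self _)
    _ ≤ c * t⁻¹ := by
        rw [norm_smul, Real.norm_of_nonneg hb.le]
        exact mul_le_mul hbc.le hz (norm_nonneg _) (hb.trans hbc).le

/-- The gauges of the solid enlargements of a bounded convex set at scales `1, 2, 3, …`. The scale
starts at `n + 1` so as to avoid division by zero at `n = 0`. -/
noncomputable def SolidScale.ofConvex (W : Set X) (hW : Convex ℝ W) (h0 : 0 ∈ W) {M : ℝ}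
    (hM : ∀ w ∈ W, ‖w‖ ≤ M) : SolidScale X where
  p n := gaugeSeminorm (balanced_solidEnlargement (W := W) (t := (n : ℝ) + 1))
    (convex_solidEnlargement hW)
    (absorbent_nhds_zero (solidEnlargement_mem_nhds h0 n.cast_add_one_pos))
  solid n _ _ h := gauge_solidEnlargement_mono h0 n.cast_add_one_pos h
  continuous n := continuous_gauge (convex_solidEnlargement hW)
    (solidEnlargement_mem_nhds h0 n.cast_add_one_pos)
  lower := ⟨_, norm_le_gauge_solidEnlargement h0 (Nat.cast_add_one_pos 0) hM⟩

end Gauge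

/-! ### Generated sublattices and ideals -/

section Generated

variable {E : Type*} [NormedAddCommGroup E] [NormedSpace ℝ E] [Lattice E]

theorem subset_latticeSpan (A : Set E) : A ⊆ latticeSpan A := fun _ ha =>
  Submodule.mem_sInf.2 fun _ hS => hS.2 ha

theorem subset_idealSpan (A : Set E) : A ⊆ idealSpan A := fun _ ha =>
  Submodule.mem_sInf.2 fun _ hS => hS.2 ha

theorem latticeSpan_le {A : Set E} {S : Submodule ℝ E} (hS : IsClosedSublattice S) (hA : A ⊆ S) :
    latticeSpan A ≤ S := sInf_le ⟨hS, hA⟩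

theorem idealSpan_le {A : Set E} {S : Submodule ℝ E} (hS : IsClosedIdeal S) (hA : A ⊆ S) :
    idealSpan A ≤ S := sInf_le ⟨hS, hA⟩

theorem isClosedSublattice_latticeSpan (A : Set E) : IsClosedSublattice (latticeSpan A) := by
  refine ⟨?_, fun x hx y hy => ?_⟩
  · rw [latticeSpan, Submodule.coe_sInf]
    exact isClosed_biInter fun S hS => hS.1.1
  · simp only [latticeSpan, Submodule.mem_sInf] at hx hy ⊢
    exact ⟨fun S hS => (hS.1.2 x (hx S hS) y (hy S hS)).1,
      fun S hS => (hS.1.2 x (hx S hS) y (hy S hS)).2⟩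

theorem isClosedIdeal_idealSpan (A : Set E) : IsClosedIdeal (idealSpan A) := by
  refine ⟨?_, fun x y hy hxy => ?_⟩
  · rw [idealSpan, Submodule.coe_sInf]
    exact isClosed_biInter fun S hS => hS.1.1
  · simp only [idealSpan, Submodule.mem_sInf] at hy ⊢
    exact fun S hS => hS.1.2 x y (hy S hS) hxy

/-- `L(A)` as a sublattice. -/
def latticeSpanSublattice (A : Set E) : VectorSublattice E where
  toSubmodule := latticeSpan A
  sup_mem' x hx y hy := ((isClosedSublattice_latticeSpan A).2 x hx y hy).1
  inf_mem' x hx y hy := ((isClosedSublattice_latticeSpan A).2 x hx y hy).2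

/-- `I(A)` as a sublattice. -/
def idealSpanSublattice [IsOrderedAddMonoid E] (A : Set E) : VectorSublattice E :=
  VectorSublattice.ofSolid (idealSpan A) fun x y => (isClosedIdeal_idealSpan A).2 x y

/-- `A` generates `L(A)` as a lattice also within `L(A)`. -/
theorem latticeSpan_preimage_coe (A : Set E) :
    latticeSpan ((↑) ⁻¹' A : Set (latticeSpanSublattice A).toSubmodule) = ⊤ := by
  refine top_unique (le_sInf fun T hT x _ => ?_)
  have hT' : latticeSpan A ≤ T.map (latticeSpan A).subtype := by
    refine latticeSpan_le ⟨?_, ?_⟩ fun a ha => ⟨⟨a, subset_latticeSpan A ha⟩, hT.2 ha, rfl⟩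
    · exact (isClosedSublattice_latticeSpan A).1.isClosedEmbedding_subtypeVal.isClosedMap _ hT.1.1
    · rintro _ ⟨x, hx, rfl⟩ _ ⟨y, hy, rfl⟩
      exact ⟨⟨_, (hT.1.2 x hx y hy).1, rfl⟩, ⟨_, (hT.1.2 x hx y hy).2, rfl⟩⟩
  obtain ⟨y, hy, hyx⟩ := hT' x.2
  rwa [← Subtype.ext hyx]

/-- `A` generates `I(A)` as an ideal also within `I(A)`. -/
theorem idealSpan_preimage_coe [IsOrderedAddMonoid E] (A : Set E) :
    idealSpan ((↑) ⁻¹' A : Set (idealSpanSublattice A).toSubmodule) = ⊤ := by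
  refine top_unique (le_sInf fun T hT x _ => ?_)
  have hT' : idealSpan A ≤ T.map (idealSpan A).subtype := by
    refine idealSpan_le ⟨?_, ?_⟩ fun a ha => ⟨⟨a, subset_idealSpan A ha⟩, hT.2 ha, rfl⟩
    · exact (isClosedIdeal_idealSpan A).1.isClosedEmbedding_subtypeVal.isClosedMap _ hT.1.1
    · rintro x _ ⟨y, hy, rfl⟩ hxy
      exact ⟨⟨x, (isClosedIdeal_idealSpan A).2 x y y.2 hxy⟩, hT.1.2 _ y hy hxy, rfl⟩
  obtain ⟨y, hy, hyx⟩ := hT' x.2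
  rwa [← Subtype.ext hyx]

variable {X : Type*} [NormedAddCommGroup X] [NormedSpace ℝ X] [Lattice X] [IsOrderedAddMonoid X]
  [HasSolidNorm X]

/-- The closure of the range of a lattice homomorphism is a closed sublattice. -/
theorem denseRange_of_latticeSpan {J : E →L[ℝ] X} (hJ : IsLatticeHom J) {K : Set X}
    (hK : K ⊆ Set.range J) (hX : latticeSpan K = ⊤) : DenseRange J := by
  have hR : ((J : E →ₗ[ℝ] X).range.topologicalClosure : Set X) = closure (Set.range J) := rfl
  have hcl : IsClosedSublattice (J : E →ₗ[ℝ] X).range.topologicalClosure := by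
    have hsup : ∀ x ∈ closure (Set.range J), ∀ y ∈ closure (Set.range J),
        x ⊔ y ∈ closure (Set.range J) := fun x hx y hy =>
      map_mem_closure₂ continuous_sup hx hy (by
        rintro _ ⟨a, rfl⟩ _ ⟨b, rfl⟩
        exact ⟨a ⊔ b, hJ a b⟩)
    refine ⟨Submodule.isClosed_topologicalClosure _, fun x hx y hy => ⟨hsup x hx y hy, ?_⟩⟩
    rw [← neg_neg (x ⊓ y), neg_inf]
    exact neg_mem (hsup _ (neg_mem hx) _ (neg_mem hy))
  have htop := latticeSpan_le hcl (hK.trans (hR ▸ subset_closure))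
  rw [hX] at htop
  exact fun x => htop (Submodule.mem_top (x := x))

/-- The closure of a solid range is a closed ideal: if `|x| ≤ |z|`, then `x` is the value at `z` of the
continuous map `z ↦ (x ⊓ |z|) ⊔ -|z|`, which sends the range to itself. -/
theorem denseRange_of_idealSpan {F : Type*} [NormedAddCommGroup F] [NormedSpace ℝ F]
    {J : F →L[ℝ] X} (hJ : ∀ x y, |x| ≤ |J y| → x ∈ Set.range J)
    {K : Set X} (hK : K ⊆ Set.range J) (hX : idealSpan K = ⊤) : DenseRange J := by
  have hR : ((J : F →ₗ[ℝ] X).range.topologicalClosure : Set X) = closure (Set.range J) := rfl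
  have hcl : IsClosedIdeal (J : F →ₗ[ℝ] X).range.topologicalClosure := by
    refine ⟨Submodule.isClosed_topologicalClosure _, fun x z hz hxz => ?_⟩
    change x ∈ closure (Set.range J)
    have hφ : Continuous fun z : X => (x ⊓ |z|) ⊔ -|z| := by
      have h1 : Continuous fun z : X => |z| := continuous_id.sup continuous_neg
      exact (continuous_const.inf h1).sup h1.neg
    have hφz : (x ⊓ |z|) ⊔ -|z| = x := by
      rw [inf_eq_left.2 ((le_abs_self x).trans hxz), sup_eq_left]
      exact neg_le.1 ((neg_le_abs x).trans hxz)
    rw [← hφz]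
    refine map_mem_closure (f := fun z : X => (x ⊓ |z|) ⊔ -|z|) hφ hz ?_
    rintro _ ⟨y, rfl⟩
    refine hJ _ y (abs_le'.2 ⟨sup_le inf_le_right (neg_le_self (abs_nonneg _)), ?_⟩)
    exact neg_le.1 le_sup_right
  have htop := idealSpan_le hcl (hK.trans (hR ▸ subset_closure))
  rw [hX] at htop
  exact fun x => htop (Submodule.mem_top (x := x))

end Generated

/-! ### Factorization -/

section Factorization

open SolidScale SolidScale.Space

variable {X : Type u} [NormedAddCommGroup X] [NormedSpace ℝ X] [Lattice X]
  [IsOrderedAddMonoid X] [IsOrderedModule ℝ X]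

/-- The scale of a weakly compact set `K`, made from the convex hull of `0` and the moduli of
elements of `K`; the origin is added so that the hull is not empty. -/
theorem exists_solidScale [HasSolidNorm X] {K : Set X} (hK : IsWeaklyCompact K) :
    ∃ 𝔭 : SolidScale X,
    (∀ k ∈ K, ∀ n, 𝔭.p n k ≤ ((n : ℝ) + 1)⁻¹) ∧
    ∀ n x, 𝔭.p n x ≤ 1 → ∃ w ∈ convexHull ℝ (insert 0 ((fun k => |k|) '' K)),
      ‖(|x| - (2 * ((n : ℝ) + 1)) • w)⁺‖ ≤ 2 * ((n : ℝ) + 1)⁻¹ := by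
  obtain ⟨M, hM⟩ := hK.exists_norm_le
  have hball : ∀ w ∈ convexHull ℝ (insert 0 ((fun k => |k|) '' K)), ‖w‖ ≤ |M| := fun w hw =>
    mem_closedBall_zero_iff.1 (convexHull_min (Set.insert_subset (by simp) (by
      rintro _ ⟨k, hk, rfl⟩
      rw [mem_closedBall_zero_iff, norm_abs_eq_norm]
      exact (hM k hk).trans (le_abs_self M))) (convex_closedBall 0 |M|) hw)
  have hpos : ∀ w ∈ convexHull ℝ (insert 0 ((fun k => |k|) '' K)), 0 ≤ w := fun w hw =>
    convexHull_min (t := Set.Ici (0 : X)) (Set.insert_subset le_rfl (by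
      rintro _ ⟨k, -, rfl⟩
      exact abs_nonneg k)) (convex_Ici (𝕜 := ℝ) (0 : X)) hw
  have h0 : 0 ∈ convexHull ℝ (insert 0 ((fun k => |k|) '' K)) :=
    subset_convexHull ℝ _ (Set.mem_insert _ _)
  refine ⟨SolidScale.ofConvex _ (convex_convexHull ℝ _) h0 hball, fun k hk n => ?_,
    fun n x hx => ?_⟩
  · exact gauge_solidEnlargement_le n.cast_add_one_pos
      (subset_convexHull ℝ _ (Set.mem_insert_of_mem _ ⟨k, hk, rfl⟩)) le_rfl
  · exact exists_norm_posPart_le_of_gauge_lt hpos h0 n.cast_add_one_pos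
      (lt_of_le_of_lt hx one_lt_two)

/-- Every sublattice `L` of the space of the scale of `K` that contains `K` has order continuous dual,
and `K` is weakly compact in `L`. The convex combinations which approximate the unit ball are
formed from moduli of elements of `K`, hence lie in `L`, so solidity of `L` is not needed. -/
theorem isWeaklyCompact_and_hasOrderContinuousDual {K : Set X} (hK : IsWeaklyCompact K)
    {𝔭 : SolidScale X} (hpK : ∀ k ∈ K, ∀ n, 𝔭.p n k ≤ ((n : ℝ) + 1)⁻¹)
    (hp : ∀ n x, 𝔭.p n x ≤ 1 → ∃ w ∈ convexHull ℝ (insert 0 ((fun k => |k|) '' K)),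
      ‖(|x| - (2 * ((n : ℝ) + 1)) • w)⁺‖ ≤ 2 * ((n : ℝ) + 1)⁻¹)
    (L : VectorSublattice 𝔭.Space) (hL : inclCLM 𝔭 ⁻¹' K ⊆ L.toSubmodule) :
    K ⊆ Set.range ((inclCLM 𝔭).comp L.toSubmodule.subtypeL) ∧
    IsWeaklyCompact ((↑) ⁻¹' (inclCLM 𝔭 ⁻¹' K) : Set L.toSubmodule) ∧
    HasOrderContinuousDual L.toSubmodule := by
  set J := (inclCLM 𝔭).comp L.toSubmodule.subtypeL with hJ
  set K' : Set L.toSubmodule := (↑) ⁻¹' (inclCLM 𝔭 ⁻¹' K) with hK'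
  have htend : Tendsto (fun n : ℕ => ((n : ℝ) + 1)⁻¹) atTop (𝓝 0) :=
    tendsto_inv_atTop_zero.comp
      (tendsto_atTop_add_const_right _ 1 tendsto_natCast_atTop_atTop)
  have hrange : ∀ k ∈ K, ∃ y, J y = k := by
    intro k hk
    obtain ⟨y, rfl⟩ := exists_incl_of_mem (𝔭 := 𝔭) (x := k)
      (squeeze_zero (fun _ => apply_nonneg _ _) (hpK k hk) htend)
    exact ⟨⟨y, hL hk⟩, rfl⟩
  have himage : J '' K' = K := by
    refine Set.Subset.antisymm (by rintro _ ⟨y, hy, rfl⟩; exact hy) fun k hk => ?_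
    obtain ⟨y, rfl⟩ := hrange k hk
    exact ⟨y, hk, rfl⟩
  have hdense : HasDenseAdjoint J := (hasDenseAdjoint_inclCLM 𝔭).comp_subtypeL _
  have hbound : ∀ k ∈ K', ‖k‖ ≤ 1 := fun k hk => norm_le fun n =>
    (hpK _ hk n).trans (inv_le_one_of_one_le₀ (by linarith [n.cast_nonneg (α := ℝ)]))
  have hK'c : IsWeaklyCompact K' :=
    hdense.isWeaklyCompact_of_image hbound (himage.symm ▸ hK)
  refine ⟨hrange, hK'c, hasOrderContinuousDual_of_approx hdense hK'c fun δ hδ => ?_⟩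
  obtain ⟨n, hn⟩ := (htend.eventually_le_const (show 0 < δ / 2 by positivity)).exists
  refine ⟨2 * ((n : ℝ) + 1), by positivity, fun y hy hy1 => ?_⟩
  obtain ⟨w, hw, hwn⟩ := hp n (J y) ((p_le_norm (y : 𝔭.Space) n).trans hy1)
  have hhull : (J : L.toSubmodule →ₗ[ℝ] X) '' convexHull ℝ (insert 0 ((fun k => |k|) '' K')) =
      convexHull ℝ (insert 0 ((fun k => |k|) '' K)) := by
    rw [LinearMap.image_convexHull, Set.image_insert_eq, map_zero, ← himage, Set.image_image,
      Set.image_image]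
    rfl
  rw [← hhull] at hw
  obtain ⟨w, hw, rfl⟩ := hw
  refine ⟨w, hw, le_trans (le_of_eq ?_) (hwn.trans (by linarith))⟩
  have habs : |J y| = J y := congrArg J (abs_of_nonneg hy)
  rw [habs]
  change ‖(J (y - (2 * ((n : ℝ) + 1)) • w))⁺‖ = _
  rw [map_sub, map_smul]
  rfl

end Factorization

end BanachLattice

theorem theorem4p3 (X : Type u) [NormedAddCommGroup X] [NormedSpace ℝ X] [CompleteSpace X]
    [Lattice X] [IsOrderedAddMonoid X] [IsOrderedModule ℝ X] [HasSolidNorm X] :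
    (BanachLattice.LWCG X →
      ∃ (Y : Type u) (_ : NormedAddCommGroup Y) (_ : NormedSpace ℝ Y) (_ : CompleteSpace Y)
        (_ : Lattice Y) (_ : IsOrderedAddMonoid Y) (_ : IsOrderedModule ℝ Y) (_ : HasSolidNorm Y)
        (J : Y →L[ℝ] X),
        BanachLattice.LWCG Y ∧ BanachLattice.IsLatticeHom J ∧
        BanachLattice.HasOrderContinuousDual Y ∧ DenseRange J) ∧
    (BanachLattice.IWCG X →
      ∃ (Y : Type u) (_ : NormedAddCommGroup Y) (_ : NormedSpace ℝ Y) (_ : CompleteSpace Y)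
        (_ : Lattice Y) (_ : IsOrderedAddMonoid Y) (_ : IsOrderedModule ℝ Y) (_ : HasSolidNorm Y)
        (J : Y →L[ℝ] X),
        BanachLattice.IWCG Y ∧ BanachLattice.IsIntervalPreserving J ∧
        BanachLattice.IsLatticeHom J ∧
        BanachLattice.HasOrderContinuousDual Y ∧ DenseRange J) := by
  open BanachLattice SolidScale.Space in
  constructor
  · rintro ⟨K, hK, hX⟩
    obtain ⟨𝔭, hpK, hp⟩ := exists_solidScale hK
    set A : Set 𝔭.Space := inclCLM 𝔭 ⁻¹' K
    obtain ⟨hKJ, hKc, hdual⟩ := isWeaklyCompact_and_hasOrderContinuousDual hK hpK hp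
      (latticeSpanSublattice A) (subset_latticeSpan A)
    have hcomplete : CompleteSpace (latticeSpanSublattice A).toSubmodule :=
      (isClosedSublattice_latticeSpan A).1.completeSpace_coe
    have hJ : IsLatticeHom ((inclCLM 𝔭).comp (latticeSpanSublattice A).toSubmodule.subtypeL) :=
      fun _ _ => rfl
    exact ⟨(latticeSpanSublattice A).toSubmodule, inferInstance, inferInstance, hcomplete,
      inferInstance, inferInstance, inferInstance, inferInstance, _,
      ⟨_, hKc, latticeSpan_preimage_coe A⟩, hJ, hdual, denseRange_of_latticeSpan hJ hKJ hX⟩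
  · rintro ⟨K, hK, hX⟩
    obtain ⟨𝔭, hpK, hp⟩ := exists_solidScale hK
    set A : Set 𝔭.Space := inclCLM 𝔭 ⁻¹' K
    obtain ⟨hKJ, hKc, hdual⟩ := isWeaklyCompact_and_hasOrderContinuousDual hK hpK hp
      (idealSpanSublattice A) (subset_idealSpan A)
    have hcomplete : CompleteSpace (idealSpanSublattice A).toSubmodule :=
      (isClosedIdeal_idealSpan A).1.completeSpace_coe
    set J := (inclCLM 𝔭).comp (idealSpanSublattice A).toSubmodule.subtypeL
    have hJ : IsLatticeHom J := fun _ _ => rfl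
    have hsolid : ∀ x y, |x| ≤ |J y| → x ∈ Set.range J := by
      intro x y hxy
      obtain ⟨z, rfl⟩ := exists_incl_eq (y := (y : 𝔭.Space)) hxy
      exact ⟨⟨z, (isClosedIdeal_idealSpan A).2 z y y.2 hxy⟩, rfl⟩
    have hint : IsIntervalPreserving J := by
      refine ⟨fun x hx => hx, fun y hy => Set.Subset.antisymm ?_ ?_⟩
      · rintro _ ⟨z, hz, rfl⟩
        exact ⟨hz.1, hz.2⟩
      · rintro x ⟨hx0, hxy⟩
        obtain ⟨z, rfl⟩ := hsolid x y (by
          rw [abs_of_nonneg hx0]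
          exact hxy.trans (le_abs_self _))
        exact ⟨z, ⟨hx0, hxy⟩, rfl⟩
    exact ⟨(idealSpanSublattice A).toSubmodule, inferInstance, inferInstance, hcomplete,
      inferInstance, inferInstance, inferInstance, inferInstance, J,
      ⟨_, hKc, idealSpan_preimage_coe A⟩, hint, hJ, hdual, denseRange_of_idealSpan hsolid hKJ hX⟩
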